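/- Let $\Sigma$ be a finite alphabet. For strings $x, y \in \Sigma^*$, the maximal site-directed insertion $x \stackrel{\rm max\text{-}sdi}{\leftarrow} y$ is the set of all strings $x_1 u z v x_2$ such that $x = x_1 u v x_2$, $y = u z v$, $u \neq \varepsilon$, $v \neq \varepsilon$, and there exist no suffix $x_1'$ of $x_1$ and prefix $x_2'$ of $x_2$ with $x_1' x_2' \neq \varepsilon$ and $y = x_1' u z' v x_2'$ for some $z' \in \Sigma^*$. The minimal site-directed insertion $x \stackrel{\rm min\text{-}sdi}{\leftarrow} y$ is the set of all strings $x_1 u z v x_2$ such that $x = x_1 u v x_2$, $y = u z v$, $u \neq \varepsilon$, $v \neq \varepsilon$, no proper nonempty suffix of $u$ is a prefix of $u$, and no proper nonempty prefix of $v$ is a suffix of $v$. Both operations are extended to languages by unions: $L_1 \odot L_2 = \bigcup_{w_1 \in L_1,\, w_2 \in L_2} w_1 \odot w_2$. A language $L \subseteq \Sigma^*$ is maximal SDI-independent (respectively, minimal SDI-independent) with respect to $R \subseteq \Sigma^*$ if $(L \odot \Sigma^+) \cap R = \emptyset$, where $\odot$ is $\stackrel{\rm max\text{-}sdi}{\leftarrow}$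 (respectively, $\stackrel{\rm min\text{-}sdi}{\leftarrow}$). Theorem. There is a polynomial-time algorithm (a Turing machine whose running time is bounded by a polynomial in the length of its input) which, given a finite alphabet $\Sigma$ and nondeterministic finite automata $A$ and $B$ over $\Sigma$, decides whether or not $L(A)$ is maximal SDI-independent with respect to $L(B)$. There is also a polynomial-time algorithm which, given the same input, decides whether or not $L(A)$ is minimal SDI-independent with respect to $L(B)$. Here an automaton is given by the number of its states, its initial state, the list of its final states and the list of its transitions, with states and letters written in binary. -/

import Mathlib

namespace SDI

/-! ### Site-directed insertions of strings and languages -/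

/-- The maximal site-directed insertion of `y` into `x`. -/
def maxSDI {α : Type*} (x y : List α) : Language α :=
  {w | ∃ x₁ u z v x₂ : List α,
    w = x₁ ++ u ++ z ++ v ++ x₂ ∧ x = x₁ ++ u ++ v ++ x₂ ∧ y = u ++ z ++ v ∧
    u ≠ [] ∧ v ≠ [] ∧
    ¬ ∃ x₁' x₂' : List α, x₁' <:+ x₁ ∧ x₂' <+: x₂ ∧ x₁' ++ x₂' ≠ [] ∧
      ∃ z' : List α, y = x₁' ++ u ++ z' ++ v ++ x₂'}

/-- The minimal site-directed insertion of `y` into `x`. -/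
def minSDI {α : Type*} (x y : List α) : Language α :=
  {w | ∃ x₁ u z v x₂ : List α,
    w = x₁ ++ u ++ z ++ v ++ x₂ ∧ x = x₁ ++ u ++ v ++ x₂ ∧ y = u ++ z ++ v ∧
    u ≠ [] ∧ v ≠ [] ∧
    (¬ ∃ s : List α, s ≠ [] ∧ s ≠ u ∧ s <:+ u ∧ s <+: u) ∧
    (¬ ∃ s : List α, s ≠ [] ∧ s ≠ v ∧ s <+: v ∧ s <:+ v)}

/-- Extension of a string operation to languages by unions. -/
def liftOp {α : Type*} (op : List α → List α → Language α) (L₁ L₂ : Language α) : Language α :=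
  {w | ∃ w₁ ∈ L₁, ∃ w₂ ∈ L₂, w ∈ op w₁ w₂}

/-- The language `Σ⁺` of all nonempty strings. -/
def sigmaPlus (α : Type*) : Language α := {w | w ≠ []}

/-- `L` is `op`-independent with respect to `R`: `(L op Σ⁺) ∩ R = ∅`. -/
def Independent {α : Type*} (op : List α → List α → Language α) (L R : Language α) : Prop :=
  liftOp op L (sigmaPlus α) ⊓ R = ⊥

/-! ### Nondeterministic finite automata as inputs of algorithms -/

/-- A nondeterministic finite automaton with one initial state over the alphabet `Fin k`, whose
states are `0, …, n - 1`. -/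
structure Automaton (k : ℕ) where
  n : ℕ
  step : Fin n → Fin k → Finset (Fin n)
  start : Fin n
  accept : Finset (Fin n)

/-- The automaton, as one of Mathlib's `NFA`s. -/
def Automaton.toNFA {k : ℕ} (A : Automaton k) : NFA (Fin k) (Fin A.n) where
  step p a := {q | q ∈ A.step p a}
  start := {A.start}
  accept := {q | q ∈ A.accept}

/-- The language accepted by the automaton. -/
def Automaton.language {k : ℕ} (A : Automaton k) : Language (Fin k) := A.toNFA.accepts

/-- The list of all triples `(p, a, q)` with `q ∈ δ(p, a)`. -/
def Automaton.transitions {k : ℕ} (A : Automaton k) : List (Fin A.n × Fin k × Fin A.n) :=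
  (List.finRange A.n ×ˢ (List.finRange k ×ˢ List.finRange A.n)).filter
    fun t => decide (t.2.2 ∈ A.step t.1 t.2.1)

/-- The list of all final states. -/
def Automaton.finals {k : ℕ} (A : Automaton k) : List (Fin A.n) :=
  (List.finRange A.n).filter fun q => decide (q ∈ A.accept)

/-- An input of the decision problems: an alphabet, and two automata over it. -/
structure Instance where
  k : ℕ
  A : Automaton k
  B : Automaton k

/-- The symbols in which inputs are written. -/
inductive InputSym
  | bit (b : Bool)
  | comma
  | bar
  deriving DecidableEq, Fintype

/-- A natural number in binary, terminated by a comma. -/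
def encodeNum (i : ℕ) : List InputSym := (Computability.encodeNat i).map InputSym.bit ++ [InputSym.comma]

/-- The number of states, the initial state, the list of final states and the list of transitions,
where all states and letters are written in binary. -/
def encodeAutomaton {k : ℕ} (A : Automaton k) : List InputSym :=
  encodeNum A.n ++ encodeNum A.start ++
    A.finals.flatMap (fun q => encodeNum q) ++ [InputSym.bar] ++
    A.transitions.flatMap (fun t => encodeNum t.1 ++ encodeNum t.2.1 ++ encodeNum t.2.2) ++
    [InputSym.bar]

/-- The size of the alphabet, followed by the two automata. -/
def encodeInstance (I : Instance) : List InputSym :=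
  encodeNum I.k ++ encodeAutomaton I.A ++ encodeAutomaton I.B

/-! ### Decidability in polynomial time -/

/-- Some Turing machine decides `P`, where inputs are written by means of `enc`, in a number of
steps that is bounded by a polynomial in the length of the input word. -/
def DecidableInPolyTime {ι Γ : Type} (enc : ι → List Γ) (P : ι → Prop) : Prop :=
  ∃ f : ι → Bool, (∀ i, f i = true ↔ P i) ∧
    Nonempty (Turing.TM2ComputableInPolyTime enc Computability.encodeBool f)

end SDI

namespace SDI

open Turing Function

/-! ### Structured programs over stacks, and their Turing machines -/

/-- A structured program that works on stacks; `ite` and `loop` inspect the top of a stack. -/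
inductive Prog {K : Type} (Γ : K → Type) : Type
  | push (k : K) (a : Γ k) : Prog Γ
  | pop (k : K) : Prog Γ
  | seq (p q : Prog Γ) : Prog Γ
  | ite (k : K) (c : Option (Γ k) → Bool) (p q : Prog Γ) : Prog Γ
  | loop (k : K) (c : Option (Γ k) → Bool) (p : Prog Γ) : Prog Γ

namespace Prog

variable {K : Type} {Γ : K → Type}

/-- The program points of a program. -/
def Lab : Prog Γ → Type
  | push _ _ => Unit
  | pop _ => Unit
  | seq p q => p.Lab ⊕ q.Lab
  | ite _ _ p q => Option (p.Lab ⊕ q.Lab)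
  | loop _ _ p => Option p.Lab

/-- The program point at which a program starts. -/
def entry : (p : Prog Γ) → p.Lab
  | push _ _ => ()
  | pop _ => ()
  | seq p _ => Sum.inl p.entry
  | ite _ _ _ _ => none
  | loop _ _ _ => none

theorem finite_lab (p : Prog Γ) : Finite p.Lab := by
  induction p with
  | push => exact inferInstanceAs (Finite Unit)
  | pop => exact inferInstanceAs (Finite Unit)
  | seq p q hp hq => exact inferInstanceAs (Finite (p.Lab ⊕ q.Lab))
  | ite _ _ p q hp hq => exact inferInstanceAs (Finite (Option (p.Lab ⊕ q.Lab)))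
  | loop _ _ p hp => exact inferInstanceAs (Finite (Option p.Lab))

/-- The statement at a program point, when program points are renamed by `e` and the program
continues at the label `x` after its end. -/
def code {Λ : Type} : (p : Prog Γ) → (p.Lab → Λ) → Λ → p.Lab → TM2.Stmt Γ Λ Bool
  | push k a, _, x, _ => .push k (fun _ => a) (.goto fun _ => x)
  | pop k, _, x, _ => .pop k (fun v _ => v) (.goto fun _ => x)
  | seq p q, e, _, Sum.inl l => p.code (fun l => e (Sum.inl l)) (e (Sum.inr q.entry)) l
  | seq _ q, e, x, Sum.inr l => q.code (fun l => e (Sum.inr l)) x l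
  | ite k c p q, e, _, none => .peek k (fun _ o => c o)
      (.branch id (.goto fun _ => e (some (Sum.inl p.entry)))
        (.goto fun _ => e (some (Sum.inr q.entry))))
  | ite _ _ p _, e, x, some (Sum.inl l) => p.code (fun l => e (some (Sum.inl l))) x l
  | ite _ _ _ q, e, x, some (Sum.inr l) => q.code (fun l => e (some (Sum.inr l))) x l
  | loop k c p, e, x, none => .peek k (fun _ o => c o)
      (.branch id (.goto fun _ => e (some p.entry)) (.goto fun _ => x))
  | loop _ _ p, e, _, some l => p.code (fun l => e (some l)) (e none) l

variable [DecidableEq K]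

/-- `Runs p s s' t`: started on the stacks `s`, the program `p` ends with the stacks `s'` after at
most `t` steps. -/
inductive Runs : Prog Γ → (∀ k, List (Γ k)) → (∀ k, List (Γ k)) → ℕ → Prop
  | push (k : K) (a : Γ k) (s) : Runs (push k a) s (update s k (a :: s k)) 1
  | pop (k : K) (s) : Runs (pop k) s (update s k (s k).tail) 1
  | seq {p q s s' s'' t t'} : Runs p s s' t → Runs q s' s'' t' → Runs (seq p q) s s'' (t + t')
  | ite_true {k c p q s s' t} : c (s k).head? = true → Runs p s s' t →
      Runs (ite k c p q) s s' (t + 1)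
  | ite_false {k c p q s s' t} : c (s k).head? = false → Runs q s s' t →
      Runs (ite k c p q) s s' (t + 1)
  | loop_done {k c p s} : c (s k).head? = false → Runs (loop k c p) s s 1
  | loop_more {k c p s s' s'' t t'} : c (s k).head? = true → Runs p s s' t →
      Runs (loop k c p) s' s'' t' → Runs (loop k c p) s s'' (t + t' + 1)
  | mono {p s s' t t'} : Runs p s s' t → t ≤ t' → Runs p s s' t'

theorem Runs.reaches {Λ : Type} {M : Λ → TM2.Stmt Γ Λ Bool} {p : Prog Γ} {s s' : ∀ k, List (Γ k)}
    {t : ℕ} (h : Runs p s s' t) (e : p.Lab → Λ) (x : Λ) (hM : ∀ l, M (e l) = p.code e x l)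
    (v : Bool) :
    ∃ n ≤ t, ∃ v', (flip bind (TM2.step M))^[n] (some ⟨some (e p.entry), v, s⟩) =
      some ⟨some x, v', s'⟩ := by
  induction h generalizing x v with
  | push k a s => exact ⟨1, le_rfl, v, congrArg (fun q => some (TM2.stepAux q v s)) (hM ())⟩
  | pop k s => exact ⟨1, le_rfl, v, congrArg (fun q => some (TM2.stepAux q v s)) (hM ())⟩
  | @seq p q s s' s'' t t' _ _ ih₁ ih₂ =>
    obtain ⟨n₁, hn₁, v₁, h₁⟩ := ih₁ (fun l => e (Sum.inl l)) (e (Sum.inr q.entry))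
      (fun l => hM (Sum.inl l)) v
    obtain ⟨n₂, hn₂, v₂, h₂⟩ := ih₂ (fun l => e (Sum.inr l)) x (fun l => hM (Sum.inr l)) v₁
    refine ⟨n₂ + n₁, by omega, v₂, ?_⟩
    rw [iterate_add_apply]
    exact (congrArg _ h₁).trans h₂
  | @ite_true k c p q s s' t hc _ ih =>
    obtain ⟨n, hn, v', h⟩ := ih (fun l => e (some (Sum.inl l))) x (fun l => hM (some (Sum.inl l)))
      true
    refine ⟨n + 1, by omega, v', ?_⟩
    rw [iterate_succ_apply, ← h]
    refine congrArg _ ((congrArg (fun q => some (TM2.stepAux q v s)) (hM none)).trans ?_)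
    simp [code, hc]
  | @ite_false k c p q s s' t hc _ ih =>
    obtain ⟨n, hn, v', h⟩ := ih (fun l => e (some (Sum.inr l))) x (fun l => hM (some (Sum.inr l)))
      false
    refine ⟨n + 1, by omega, v', ?_⟩
    rw [iterate_succ_apply, ← h]
    refine congrArg _ ((congrArg (fun q => some (TM2.stepAux q v s)) (hM none)).trans ?_)
    simp [code, hc]
  | @loop_done k c p s hc =>
    refine ⟨1, le_rfl, false, (congrArg (fun q => some (TM2.stepAux q v s)) (hM none)).trans ?_⟩
    simp [code, hc]
  | @loop_more k c p s s' s'' t t' hc _ _ ih₁ ih₂ =>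
    obtain ⟨n₁, hn₁, v₁, h₁⟩ := ih₁ (fun l => e (some l)) (e none) (fun l => hM (some l)) true
    obtain ⟨n₂, hn₂, v₂, h₂⟩ := ih₂ e x hM v₁
    refine ⟨n₂ + n₁ + 1, by omega, v₂, ?_⟩
    rw [iterate_succ_apply, iterate_add_apply]
    refine (congrArg _ (Eq.trans (congrArg _ ?_) h₁)).trans h₂
    refine (congrArg (fun q => some (TM2.stepAux q v s)) (hM none)).trans ?_
    simp [code, hc]
  | mono _ ht ih =>
    obtain ⟨n, hn, h⟩ := ih e x hM v
    exact ⟨n, hn.trans ht, h⟩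

/-- The Turing machine of a program. -/
noncomputable def machine [Fintype K] (p : Prog Γ) (k₀ k₁ : K) [Fintype (Γ k₀)] : FinTM2 :=
  haveI := p.finite_lab
  { K := K
    k₀ := k₀
    k₁ := k₁
    Γ := Γ
    Λ := Option p.Lab
    main := some p.entry
    ΛFin := Fintype.ofFinite _
    σ := Bool
    initialState := false
    m := fun l => l.elim (.load (fun _ => false) .halt) (p.code some none) }

theorem Runs.outputs [Fintype K] {p : Prog Γ} {k₀ k₁ : K} [Fintype (Γ k₀)] {l : List (Γ k₀)}
    {l' : List (Γ k₁)} {t : ℕ}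
    (h : Runs p (update (fun _ => []) k₀ l) (update (fun _ => []) k₁ l') t) :
    Nonempty (TM2OutputsInTime (p.machine k₀ k₁) l (some l') (t + 1)) := by
  obtain ⟨n, hn, v', h⟩ := h.reaches (M := (p.machine k₀ k₁).m) some none (fun l => rfl) false
  refine ⟨⟨⟨n + 1, ?_⟩, Nat.succ_le_succ hn⟩⟩
  rw [iterate_succ_apply']
  have key (k₂ : K) (w : List (Γ k₂)) : (fun k : K =>
      @dite (List (Γ k)) (k = k₂) _ (fun h => by rw [h]; exact w) fun _ => []) =
      update (fun _ => []) k₂ w := by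
    funext k
    by_cases hk : k = k₂
    · subst hk
      simp
    · simp [hk]
  have hi : initList (p.machine k₀ k₁) l =
      ⟨some (some p.entry), false, update (fun _ => []) k₀ l⟩ :=
    congrArg (TM2.Cfg.mk (some (some p.entry)) false) (key k₀ l)
  have ho : haltList (p.machine k₀ k₁) l' = ⟨none, false, update (fun _ => []) k₁ l'⟩ :=
    congrArg (TM2.Cfg.mk none false) (key k₁ l')
  rw [hi]
  refine (congrArg _ h).trans (Eq.trans ?_ (congrArg some ho).symm)
  rfl

end Prog

end SDI

namespace SDI

open Function

/-! ### Programs on trees -/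

/-- Binary trees, the values that programs compute with. -/
inductive BTree
  | leaf
  | node (l r : BTree)

namespace BTree

/-- A prefix code for trees. -/
def code : BTree → List Bool
  | leaf => [false]
  | node l r => true :: (l.code ++ r.code)

/-- The length of the code of a tree. -/
def size (d : BTree) : ℕ := d.code.length

@[simp] theorem size_leaf : leaf.size = 1 := rfl

@[simp] theorem size_node (l r : BTree) : (node l r).size = l.size + r.size + 1 := by
  simp [size, code]

theorem size_pos (d : BTree) : 0 < d.size := by cases d <;> simp

/-- The left subtree of a tree. -/
def left : BTree → BTree
  | leaf => leaf
  | node l _ => l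

/-- The right subtree of a tree. -/
def right : BTree → BTree
  | leaf => leaf
  | node _ r => r

end BTree

/-- The stacks of our machines: the input, two stacks that hold the codes of trees, and two stacks
that are empty between the operations on trees. -/
inductive Stk
  | inp
  | main
  | aux
  | tmp
  | cnt
  deriving DecidableEq

instance : Fintype Stk :=
  ⟨{.inp, .main, .aux, .tmp, .cnt}, fun k => by cases k <;> decide⟩

/-- The stack alphabets. -/
def Stk.Sym : Stk → Type
  | inp => InputSym
  | main => Bool
  | aux => Bool
  | tmp => Bool
  | cnt => Bool

/-- Given contents of the stacks. -/
def cfg (i : List InputSym) (m a t c : List Bool) : ∀ k : Stk, List k.Sym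
  | .inp => i
  | .main => m
  | .aux => a
  | .tmp => t
  | .cnt => c

namespace Prog

section Basic

variable {i : List InputSym} {m a t c : List Bool} {b : Bool} {p q : Prog Stk.Sym}
  {s' : ∀ k : Stk, List k.Sym} {n : ℕ}

theorem runs_of_eq {s₁ s₂ s₃ s₄ : ∀ k : Stk, List k.Sym} (h : Runs p s₁ s₂ n) (h₁ : s₁ = s₃)
    (h₂ : s₂ = s₄) : Runs p s₃ s₄ n := h₁ ▸ h₂ ▸ h

theorem runs_pop_inp {x : InputSym} : Runs (pop Stk.inp) (cfg (x :: i) m a t c)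
    (cfg i m a t c) 1 :=
  runs_of_eq (Runs.pop Stk.inp _) rfl (by funext k; cases k <;> rfl)

theorem runs_push_main : Runs (push (Γ := Stk.Sym) Stk.main b) (cfg i m a t c)
    (cfg i (b :: m) a t c) 1 :=
  runs_of_eq (Runs.push Stk.main _ _) rfl (by funext k; cases k <;> rfl)

theorem runs_push_aux : Runs (push (Γ := Stk.Sym) Stk.aux b) (cfg i m a t c)
    (cfg i m (b :: a) t c) 1 :=
  runs_of_eq (Runs.push Stk.aux _ _) rfl (by funext k; cases k <;> rfl)

theorem runs_push_tmp : Runs (push (Γ := Stk.Sym) Stk.tmp b) (cfg i m a t c)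
    (cfg i m a (b :: t) c) 1 :=
  runs_of_eq (Runs.push Stk.tmp _ _) rfl (by funext k; cases k <;> rfl)

theorem runs_push_cnt : Runs (push (Γ := Stk.Sym) Stk.cnt b) (cfg i m a t c)
    (cfg i m a t (b :: c)) 1 :=
  runs_of_eq (Runs.push Stk.cnt _ _) rfl (by funext k; cases k <;> rfl)

theorem runs_pop_main : Runs (pop Stk.main) (cfg i (b :: m) a t c) (cfg i m a t c) 1 :=
  runs_of_eq (Runs.pop Stk.main _) rfl (by funext k; cases k <;> rfl)

theorem runs_pop_aux : Runs (pop Stk.aux) (cfg i m (b :: a) t c) (cfg i m a t c) 1 :=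
  runs_of_eq (Runs.pop Stk.aux _) rfl (by funext k; cases k <;> rfl)

theorem runs_pop_tmp : Runs (pop Stk.tmp) (cfg i m a (b :: t) c) (cfg i m a t c) 1 :=
  runs_of_eq (Runs.pop Stk.tmp _) rfl (by funext k; cases k <;> rfl)

theorem runs_pop_cnt : Runs (pop Stk.cnt) (cfg i m a t (b :: c)) (cfg i m a t c) 1 :=
  runs_of_eq (Runs.pop Stk.cnt _) rfl (by funext k; cases k <;> rfl)

/-- A program that does nothing. -/
def skip : Prog Stk.Sym := loop Stk.cnt (fun _ => false) (pop Stk.cnt)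

theorem runs_skip {s : ∀ k : Stk, List k.Sym} : Runs skip s s 1 := Runs.loop_done rfl

theorem Runs.seq' {s s₁ s₂ : ∀ k : Stk, List k.Sym} {n₁ n₂ : ℕ} (h₁ : Runs p s s₁ n₁)
    (h₂ : Runs q s₁ s₂ n₂) (hn : n₁ + n₂ ≤ n) : Runs (p.seq q) s s₂ n :=
  (h₁.seq h₂).mono hn

/-- The test that a bit is on top of a stack, and set. -/
def isSet (o : Option Bool) : Bool := o.getD false

/-- Branches according to the top bit of `main`. -/
def ifMain (p q : Prog Stk.Sym) : Prog Stk.Sym := ite Stk.main isSet p q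

/-- Branches according to the top bit of `aux`. -/
def ifAux (p q : Prog Stk.Sym) : Prog Stk.Sym := ite Stk.aux isSet p q

/-- Moves as many trees to `tmp`, in reverse, as there are symbols on `cnt`. The arguments are the
test of the top bit and its removal. -/
def scanLoop (test : Prog Stk.Sym → Prog Stk.Sym → Prog Stk.Sym) (del : Prog Stk.Sym) :
    Prog Stk.Sym :=
  loop Stk.cnt (fun o => o.isSome) <| seq (pop Stk.cnt) <|
    test
      (seq del <| seq (push (Γ := Stk.Sym) Stk.tmp true) <|
        seq (push (Γ := Stk.Sym) Stk.cnt true) (push (Γ := Stk.Sym) Stk.cnt true))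
      (seq del <| push (Γ := Stk.Sym) Stk.tmp false)

/-- Moves the topmost tree to `tmp`, in reverse. -/
def scan (test : Prog Stk.Sym → Prog Stk.Sym → Prog Stk.Sym) (del : Prog Stk.Sym) :
    Prog Stk.Sym :=
  seq (push (Γ := Stk.Sym) Stk.cnt true) (scanLoop test del)

theorem runs_scan {test : Prog Stk.Sym → Prog Stk.Sym → Prog Stk.Sym} {del : Prog Stk.Sym}
    {G : List Bool → List Bool × List Bool}
    (htrue : ∀ x t c s n p q, Runs p (cfg i (G (true :: x)).1 (G (true :: x)).2 t c) s n →
      Runs (test p q) (cfg i (G (true :: x)).1 (G (true :: x)).2 t c) s (n + 1))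
    (hfalse : ∀ x t c s n p q, Runs q (cfg i (G (false :: x)).1 (G (false :: x)).2 t c) s n →
      Runs (test p q) (cfg i (G (false :: x)).1 (G (false :: x)).2 t c) s (n + 1))
    (hdel : ∀ b x t c, Runs del (cfg i (G (b :: x)).1 (G (b :: x)).2 t c)
      (cfg i (G x).1 (G x).2 t c) 1) (d : BTree) (x : List Bool) :
    Runs (scan test del) (cfg i (G (d.code ++ x)).1 (G (d.code ++ x)).2 [] [])
      (cfg i (G x).1 (G x).2 d.code.reverse []) (7 * d.size + 2) := by
  have key : ∀ (d : BTree) (x t c s n),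
      Runs (scanLoop test del) (cfg i (G x).1 (G x).2 (d.code.reverse ++ t) c) s n →
      Runs (scanLoop test del) (cfg i (G (d.code ++ x)).1 (G (d.code ++ x)).2 t (true :: c)) s
        (n + 7 * d.size) := by
    intro d
    induction d with
    | leaf =>
      intro x t c s n h
      refine Runs.mono (Runs.loop_more rfl (Runs.seq runs_pop_cnt
        (hfalse x _ _ _ _ _ _ (Runs.seq (hdel _ _ _ _) runs_push_tmp))) h) ?_
      simp only [BTree.size_leaf]
      omega
    | node l r hl hr =>
      intro x t c s n h
      have e : (BTree.node l r).code ++ x = true :: (l.code ++ (r.code ++ x)) := by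
        simp [BTree.code]
      rw [e]
      refine Runs.mono (Runs.loop_more rfl (Runs.seq runs_pop_cnt
        (htrue _ _ _ _ _ _ _ (Runs.seq (hdel _ _ _ _) (Runs.seq runs_push_tmp
          (Runs.seq runs_push_cnt runs_push_cnt))))) (hl _ _ _ _ _ (hr _ _ _ _ n ?_))) ?_
      · simpa [BTree.code] using h
      · simp only [BTree.size_node]
        omega
  refine Runs.mono (Runs.seq runs_push_cnt (key d x [] [] _ 1 (runs_of_eq (Runs.loop_done rfl)
    rfl ?_))) (by omega)
  simp

theorem runs_ifMain_true (h : Runs p (cfg i (true :: m) a t c) s' n) :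
    Runs (ifMain p q) (cfg i (true :: m) a t c) s' (n + 1) := Runs.ite_true rfl h

theorem runs_ifMain_false (h : Runs q (cfg i (false :: m) a t c) s' n) :
    Runs (ifMain p q) (cfg i (false :: m) a t c) s' (n + 1) := Runs.ite_false rfl h

theorem runs_scan_main (d : BTree) : Runs (scan ifMain (pop Stk.main))
    (cfg i (d.code ++ m) a [] []) (cfg i m a d.code.reverse []) (7 * d.size + 2) :=
  runs_scan (G := fun x => (x, a)) (fun _ _ _ _ _ _ _ h => Runs.ite_true rfl h)
    (fun _ _ _ _ _ _ _ h => Runs.ite_false rfl h) (fun _ _ _ _ => runs_pop_main) d m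

theorem runs_scan_aux (d : BTree) : Runs (scan ifAux (pop Stk.aux))
    (cfg i m (d.code ++ a) [] []) (cfg i m a d.code.reverse []) (7 * d.size + 2) :=
  runs_scan (G := fun x => (m, x)) (fun _ _ _ _ _ _ _ h => Runs.ite_true rfl h)
    (fun _ _ _ _ _ _ _ h => Runs.ite_false rfl h) (fun _ _ _ _ => runs_pop_aux) d a

/-- Empties `tmp`, and treats its symbols by `put`. -/
def pour (put : Bool → Prog Stk.Sym) : Prog Stk.Sym :=
  loop Stk.tmp (fun o => o.isSome) <|
    ite Stk.tmp isSet (seq (pop Stk.tmp) (put true)) (seq (pop Stk.tmp) (put false))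

theorem runs_pour {put : Bool → Prog Stk.Sym} {G : List Bool → List Bool × List Bool}
    (hput : ∀ b x t, Runs (put b) (cfg i (G x).1 (G x).2 t [])
      (cfg i (G (b :: x)).1 (G (b :: x)).2 t []) 2) (t x : List Bool) :
    Runs (pour put) (cfg i (G x).1 (G x).2 t [])
      (cfg i (G (t.reverse ++ x)).1 (G (t.reverse ++ x)).2 [] []) (5 * t.length + 1) := by
  induction t generalizing x with
  | nil => exact Runs.loop_done rfl
  | cons b t ih =>
    have e : (b :: t).reverse ++ x = t.reverse ++ b :: x := by simp
    rw [e]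
    refine Runs.mono (Runs.loop_more rfl (t := 4) ?_ (ih (b :: x))) ?_
    · cases b
      · exact Runs.ite_false rfl (Runs.seq runs_pop_tmp (hput _ _ _))
      · exact Runs.ite_true rfl (Runs.seq runs_pop_tmp (hput _ _ _))
    · simp only [List.length_cons]
      omega

theorem runs_pour_code {put : Bool → Prog Stk.Sym} {G : List Bool → List Bool × List Bool}
    (hput : ∀ b x t, Runs (put b) (cfg i (G x).1 (G x).2 t [])
      (cfg i (G (b :: x)).1 (G (b :: x)).2 t []) 2) (d : BTree) (x : List Bool) :
    Runs (pour put) (cfg i (G x).1 (G x).2 d.code.reverse [])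
      (cfg i (G (d.code ++ x)).1 (G (d.code ++ x)).2 [] []) (5 * d.size + 1) := by
  simpa [BTree.size] using runs_pour hput d.code.reverse x

/-- Moves a tree from `main` to `aux`. -/
def toAux : Prog Stk.Sym :=
  seq (scan ifMain (pop Stk.main)) (pour fun b => push (Γ := Stk.Sym) Stk.aux b)

/-- Moves a tree from `aux` to `main`. -/
def toMain : Prog Stk.Sym :=
  seq (scan ifAux (pop Stk.aux)) (pour fun b => push (Γ := Stk.Sym) Stk.main b)

/-- Copies a tree from `main` to `aux`. -/
def copyAux : Prog Stk.Sym :=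
  seq (scan ifMain (pop Stk.main))
    (pour fun b => seq (push (Γ := Stk.Sym) Stk.main b) (push (Γ := Stk.Sym) Stk.aux b))

/-- Deletes a tree on `main`. -/
def drop : Prog Stk.Sym := seq (scan ifMain (pop Stk.main)) (pour fun _ => skip)

theorem runs_toAux (d : BTree) : Runs toAux (cfg i (d.code ++ m) a [] [])
    (cfg i m (d.code ++ a) [] []) (12 * d.size + 3) :=
  (runs_scan_main d).seq' (runs_pour_code (G := fun x => (m, x))
    (fun _ _ _ => runs_push_aux.mono one_le_two) d a) (by omega)

theorem runs_toMain (d : BTree) : Runs toMain (cfg i m (d.code ++ a) [] [])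
    (cfg i (d.code ++ m) a [] []) (12 * d.size + 3) :=
  (runs_scan_aux d).seq' (runs_pour_code (G := fun x => (x, a))
    (fun _ _ _ => runs_push_main.mono one_le_two) d m) (by omega)

theorem runs_copyAux (d : BTree) : Runs copyAux (cfg i (d.code ++ m) a [] [])
    (cfg i (d.code ++ m) (d.code ++ a) [] []) (12 * d.size + 3) :=
  (runs_scan_main d).seq' (runs_pour_code (G := fun x => (x ++ m, x ++ a))
    (fun _ _ _ => runs_push_main.seq runs_push_aux) d []|> fun h => by
      simpa using h) (by omega)

theorem runs_drop (d : BTree) : Runs drop (cfg i (d.code ++ m) a [] [])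
    (cfg i m a [] []) (12 * d.size + 3) :=
  (runs_scan_main d).seq' (runs_pour_code (G := fun _ => (m, a))
    (fun _ _ _ => runs_skip.mono one_le_two) d []) (by omega)

/-- Pushes a list of bits on `main`. -/
def pushAll : List Bool → Prog Stk.Sym
  | [] => skip
  | b :: l => seq (pushAll l) (push (Γ := Stk.Sym) Stk.main b)

theorem runs_pushAll (l : List Bool) : Runs (pushAll l) (cfg i m a t c)
    (cfg i (l ++ m) a t c) (l.length + 1) := by
  induction l with
  | nil => exact runs_skip
  | cons b l ih => exact ih.seq' runs_push_main (by simp)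

end Basic

end Prog

end SDI

namespace SDI

open Prog

/-! ### Functions computable in polynomial time -/

/-- Types whose elements are represented by trees. -/
class TreeRep (α : Type) where
  /-- The tree that represents an element. -/
  rep : α → BTree

open TreeRep

instance : TreeRep Bool := ⟨fun b => if b then .node .leaf .leaf else .leaf⟩

instance {α β : Type} [TreeRep α] [TreeRep β] : TreeRep (α × β) :=
  ⟨fun x => .node (rep x.1) (rep x.2)⟩

/-- The tree of a list. -/
def listRep {α : Type} [TreeRep α] : List α → BTree
  | [] => .leaf
  | x :: l => .node (rep x) (listRep l)

instance {α : Type} [TreeRep α] : TreeRep (List α) := ⟨listRep⟩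

section Rep

variable {α β : Type} [TreeRep α] [TreeRep β]

theorem rep_cons (x : α) (l : List α) : rep (x :: l) = .node (rep x) (rep l) := rfl

theorem rep_mk (x : α) (y : β) : rep (x, y) = .node (rep x) (rep y) := rfl

/-- The size of the tree that represents an element. -/
def rsize (x : α) : ℕ := (rep x).size

@[simp] theorem rsize_nil : rsize ([] : List α) = 1 := rfl

@[simp] theorem rsize_cons (x : α) (l : List α) : rsize (x :: l) = rsize x + rsize l + 1 := by
  simp [rsize, rep_cons]

@[simp] theorem rsize_mk (x : α) (y : β) : rsize (x, y) = rsize x + rsize y + 1 := by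
  simp [rsize, rep_mk]

theorem rsize_append (l l' : List α) : rsize (l ++ l') + 1 = rsize l + rsize l' := by
  induction l with
  | nil => simp; omega
  | cons x l ih => simp; omega

theorem rsize_reverse (l : List α) : rsize l.reverse = rsize l := by
  induction l with
  | nil => rfl
  | cons x l ih =>
    have := rsize_append l.reverse [x]
    simp at this ⊢
    omega

theorem length_lt_rsize (l : List α) : l.length < rsize l := by
  induction l with
  | nil => simp
  | cons x l ih =>
    simp
    omega

theorem rsize_le_of_mem {x : α} {l : List α} (h : x ∈ l) : rsize x ≤ rsize l := by
  induction l with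
  | nil => simp at h
  | cons y l ih =>
    rcases List.mem_cons.1 h with rfl | h
    · simp; omega
    · have := ih h
      simp; omega

end Rep

theorem eval_le_eval (P : Polynomial ℕ) {a b : ℕ} (h : a ≤ b) : P.eval a ≤ P.eval b := by
  rw [Polynomial.eval_eq_sum, Polynomial.eval_eq_sum]
  exact Finset.sum_le_sum fun n _ => Nat.mul_le_mul_left _ (Nat.pow_le_pow_left h n)

/-- `PT f`: some program computes `f` on trees in polynomial time. -/
def PT {α β : Type} [TreeRep α] [TreeRep β] (f : α → β) : Prop :=
  ∃ (p : Prog Stk.Sym) (P : Polynomial ℕ), ∀ x, rsize (f x) ≤ P.eval (rsize x) ∧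
    ∀ i m a, Runs p (cfg i ((rep x).code ++ m) a [] []) (cfg i ((rep (f x)).code ++ m) a [] [])
      (P.eval (rsize x))

namespace PT

variable {α β γ δ : Type} [TreeRep α] [TreeRep β] [TreeRep γ] [TreeRep δ]

open Polynomial in
theorem of_rep_eq {f : α → β} (h : ∀ x, rep (f x) = rep x) : PT f := by
  refine ⟨skip, X + 1, fun x => ⟨?_, fun i m a => ?_⟩⟩
  · simp [rsize, h]
  · rw [h]
    exact runs_skip.mono (by simp)

theorem id : PT fun x : α => x := of_rep_eq fun _ => rfl

open Polynomial in
theorem const (b : β) : PT fun _ : α => b := by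
  refine ⟨seq drop (pushAll (rep b).code), C 12 * X + C (rsize b + 4), fun x =>
    ⟨?_, fun i m a => ?_⟩⟩
  · simp; omega
  · refine ((runs_drop (rep x)).seq (runs_pushAll _)).mono ?_
    simp [rsize, BTree.size]; omega

open Polynomial in
theorem comp {g : β → γ} {f : α → β} (hg : PT g) (hf : PT f) : PT fun x => g (f x) := by
  obtain ⟨p, P, hp⟩ := hf
  obtain ⟨q, Q, hq⟩ := hg
  refine ⟨seq p q, P + Q.comp P, fun x => ⟨?_, fun i m a => ?_⟩⟩
  · have h₁ := (hq (f x)).1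
    have h₂ := eval_le_eval Q (hp x).1
    simp [eval_comp]; omega
  · refine (((hp x).2 i m a).seq ((hq (f x)).2 i m a)).mono ?_
    have h₂ := eval_le_eval Q (hp x).1
    simp [eval_comp]; omega

open Polynomial in
theorem pair {f : α → β} {g : α → γ} (hf : PT f) (hg : PT g) : PT fun x => (f x, g x) := by
  obtain ⟨p, P, hp⟩ := hf
  obtain ⟨q, Q, hq⟩ := hg
  refine ⟨seq copyAux (seq q (seq toMain (seq p (push (Γ := Stk.Sym) .main true)))),
    C 24 * X + P + Q + C 7, fun x => ⟨?_, fun i m a => ?_⟩⟩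
  · have h₁ := (hp x).1
    have h₂ := (hq x).1
    simp; omega
  · have e : (rep (f x, g x)).code ++ m =
        true :: ((rep (f x)).code ++ ((rep (g x)).code ++ m)) := by
      simp [rep_mk, BTree.code]
    rw [e]
    refine ((runs_copyAux (rep x)).seq (((hq x).2 _ _ _).seq ((runs_toMain (rep x)).seq
      (((hp x).2 _ _ _).seq runs_push_main)))).mono ?_
    simp [rsize]; omega

open Polynomial in
theorem of_rep_eq_left {f : α → β} (h : ∀ x, rep (f x) = (rep x).left) : PT f := by
  refine ⟨ifMain (seq (pop .main) (seq toAux (seq drop toMain))) skip, C 36 * X + C 15, fun x =>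
    ⟨?_, fun i m a => ?_⟩⟩
  · simp only [rsize, h]
    cases rep x <;> simp [BTree.left]; omega
  · simp only [rsize, h]
    cases rep x with
    | leaf => exact (runs_ifMain_false runs_skip).mono (by simp)
    | node l r =>
      have e : (BTree.node l r).code ++ m = true :: (l.code ++ (r.code ++ m)) := by
        simp [BTree.code]
      rw [e]
      refine (runs_ifMain_true (runs_pop_main.seq ((runs_toAux l).seq ((runs_drop r).seq
        (runs_toMain l))))).mono ?_
      simp; omega

open Polynomial in
theorem of_rep_eq_right {f : α → β} (h : ∀ x, rep (f x) = (rep x).right) : PT f := by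
  refine ⟨ifMain (seq (pop .main) drop) skip, C 12 * X + C 15, fun x =>
    ⟨?_, fun i m a => ?_⟩⟩
  · simp only [rsize, h]
    cases rep x <;> simp [BTree.right]; omega
  · simp only [rsize, h]
    cases rep x with
    | leaf => exact (runs_ifMain_false runs_skip).mono (by simp)
    | node l r =>
      have e : (BTree.node l r).code ++ m = true :: (l.code ++ (r.code ++ m)) := by
        simp [BTree.code]
      rw [e]
      refine (runs_ifMain_true (runs_pop_main.seq (runs_drop l))).mono ?_
      simp; omega

theorem fst {f : α → β × γ} (h : PT f) : PT fun x => (f x).1 :=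
  (of_rep_eq_left (f := Prod.fst) fun _ => rfl).comp h

theorem snd {f : α → β × γ} (h : PT f) : PT fun x => (f x).2 :=
  (of_rep_eq_right (f := Prod.snd) fun _ => rfl).comp h

theorem cons {f : α → β} {l : α → List β} (hf : PT f) (hl : PT l) : PT fun x => f x :: l x :=
  (of_rep_eq (f := fun p : β × List β => p.1 :: p.2) fun _ => rfl).comp (hf.pair hl)

theorem tail {l : α → List β} (hl : PT l) : PT fun x => (l x).tail :=
  (of_rep_eq_right (f := List.tail) fun l => by cases l <;> rfl).comp hl

theorem headI [Inhabited β] (hβ : rep (default : β) = .leaf) {l : α → List β} (hl : PT l) :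
    PT fun x => (l x).headI :=
  (of_rep_eq_left (f := List.headI) fun l => by cases l; exacts [hβ, rfl]).comp hl

open Polynomial in
theorem branch {c : α → γ} {f g F : α → β} (hc : PT c) (hf : PT f) (hg : PT g)
    (hleaf : ∀ x, rep (c x) = .leaf → F x = f x) (hnode : ∀ x, rep (c x) ≠ .leaf → F x = g x) :
    PT F := by
  obtain ⟨r, R, hr⟩ := hc
  obtain ⟨p, P, hp⟩ := hf
  obtain ⟨q, Q, hq⟩ := hg
  refine ⟨seq copyAux (seq r (ifMain (seq drop (seq toMain q)) (seq drop (seq toMain p)))),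
    C 24 * X + C 13 * R + P + Q + C 10, fun x => ?_⟩
  have hrx := (hr x).1
  by_cases hx : rep (c x) = .leaf
  · rw [hleaf x hx]
    refine ⟨?_, fun i m a => ?_⟩
    · have := (hp x).1
      simp; omega
    · have e : (rep (c x)).code = [false] := by rw [hx]; rfl
      have hd := runs_drop (i := i) (m := m) (a := (rep x).code ++ a) (rep (c x))
      have h₁ := (hr x).2 i m ((rep x).code ++ a)
      rw [e] at hd h₁
      refine ((runs_copyAux (rep x)).seq (h₁.seq (runs_ifMain_false (hd.seq
        ((runs_toMain (rep x)).seq ((hp x).2 i m a)))))).mono ?_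
      simp [rsize] at hrx ⊢; omega
  · rw [hnode x hx]
    refine ⟨?_, fun i m a => ?_⟩
    · have := (hq x).1
      simp; omega
    · obtain ⟨w, e⟩ : ∃ w, (rep (c x)).code = true :: w := by
        cases h : rep (c x) with
        | leaf => exact absurd h hx
        | node l r => exact ⟨_, rfl⟩
      have hd := runs_drop (i := i) (m := m) (a := (rep x).code ++ a) (rep (c x))
      have h₁ := (hr x).2 i m ((rep x).code ++ a)
      rw [e] at hd h₁
      refine ((runs_copyAux (rep x)).seq (h₁.seq (runs_ifMain_true (hd.seq
        ((runs_toMain (rep x)).seq ((hq x).2 i m a)))))).mono ?_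
      simp [rsize] at hrx ⊢; omega

theorem ite {c : α → Bool} {f g : α → β} (hc : PT c) (hf : PT f) (hg : PT g) :
    PT fun x => if c x then f x else g x := by
  refine branch hc hg hf (fun x hx => ?_) (fun x hx => ?_)
  · cases h : c x
    · simp
    · rw [h] at hx; cases hx
  · cases h : c x
    · rw [h] at hx; exact absurd rfl hx
    · simp

theorem and {c d : α → Bool} (hc : PT c) (hd : PT d) : PT fun x => c x && d x := by
  convert hc.ite hd (const false) using 2 with x
  cases c x <;> simp

theorem or {c d : α → Bool} (hc : PT c) (hd : PT d) : PT fun x => c x || d x := by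
  convert hc.ite (const true) hd using 2 with x
  cases c x <;> simp

theorem not {c : α → Bool} (hc : PT c) : PT fun x => !c x := by
  convert hc.ite (const false) (const true) using 2 with x
  cases c x <;> simp

theorem isEmpty {l : α → List β} (hl : PT l) : PT fun x => (l x).isEmpty := by
  refine branch hl (const true) (const false) (fun x hx => ?_) (fun x hx => ?_)
  · cases h : l x
    · rfl
    · rw [h] at hx; cases hx
  · cases h : l x
    · rw [h] at hx; exact absurd rfl hx
    · rfl

/-- The loop that folds over the list on `aux`. -/
def foldLoop (p : Prog Stk.Sym) : Prog Stk.Sym :=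
  loop .aux isSet (seq (pop .aux) (seq toMain (seq (push (Γ := Stk.Sym) .main true) p)))

theorem runs_foldLoop {p : Prog Stk.Sym} {P : Polynomial ℕ} {step : β → γ → β}
    (hp : ∀ x y i m a, Runs p (cfg i ((rep (x, y)).code ++ m) a [] [])
      (cfg i ((rep (step y x)).code ++ m) a [] []) (P.eval (rsize (x, y))))
    (B S : ℕ) (i : List InputSym) (m a : List Bool) (l : List γ) (y : β)
    (hS : ∀ x ∈ l, rsize x ≤ S) (hB : ∀ l', l' <+: l → rsize (l'.foldl step y) ≤ B) :
    Runs (foldLoop p) (cfg i ((rep y).code ++ m) ((rep l).code ++ a) [] [])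
      (cfg i ((rep (l.foldl step y)).code ++ m) (false :: a) [] [])
      (l.length * (12 * S + P.eval (S + B + 1) + 6) + 1) := by
  induction l generalizing y with
  | nil => exact (Runs.loop_done rfl).mono (by omega)
  | cons x l ih =>
    have e : (rep (x :: l)).code ++ a = true :: ((rep x).code ++ ((rep l).code ++ a)) := by
      simp [rep_cons, BTree.code]
    have e' : (rep (x, y)).code ++ m = true :: ((rep x).code ++ ((rep y).code ++ m)) := by
      simp [rep_mk, BTree.code]
    have h := hp x y i m ((rep l).code ++ a)
    rw [e'] at h
    have hrest := ih (step y x) (fun z hz => hS z (List.mem_cons_of_mem _ hz))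
      (fun l' hl' => hB (x :: l') (List.prefix_cons_inj _ |>.2 hl'))
    rw [e]
    refine (Runs.loop_more rfl (runs_pop_aux.seq ((runs_toMain (rep x)).seq
      (runs_push_main.seq h))) hrest).mono ?_
    have h₁ : rsize x ≤ S := hS x List.mem_cons_self
    have h₂ : rsize y ≤ B := hB [] List.nil_prefix
    have h₃ : P.eval (rsize (x, y)) ≤ P.eval (S + B + 1) := eval_le_eval P (by simp; omega)
    simp only [List.length_cons, Nat.succ_mul]
    have h₄ : (rep x).size ≤ S := h₁
    omega

open Polynomial in
theorem foldl_of_bound {l : α → List γ} {init : α → β} {step : β → γ → β} (hl : PT l)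
    (hi : PT init) (hs : PT fun p : γ × β => step p.2 p.1) (Q : Polynomial ℕ)
    (hQ : ∀ x l', l' <+: l x → rsize (l'.foldl step (init x)) ≤ Q.eval (rsize x)) :
    PT fun x => (l x).foldl step (init x) := by
  obtain ⟨r, R, hr⟩ := hl.pair hi
  obtain ⟨p, P, hp⟩ := hs
  refine ⟨seq r (seq (pop .main) (seq toAux (seq (foldLoop p) (pop .aux)))),
    R + C 12 * R + Q + R * (C 12 * R + P.comp (R + Q + 1) + C 6) + C 10, fun x => ⟨?_, ?_⟩⟩
  · have := hQ x _ List.prefix_rfl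
    simp; omega
  · intro i m a
    have h₀ := (hr x).1
    have h₁ := (hr x).2 i m a
    have e : (rep (l x, init x)).code ++ m =
        true :: ((rep (l x)).code ++ ((rep (init x)).code ++ m)) := by
      simp [rep_mk, BTree.code]
    rw [e] at h₁
    have hl₀ : rsize (l x) ≤ R.eval (rsize x) := by simp at h₀; omega
    refine (h₁.seq (runs_pop_main.seq ((runs_toAux (rep (l x))).seq
      ((runs_foldLoop (fun x y i m a => (hp (x, y)).2 i m a) (Q.eval (rsize x))
        (R.eval (rsize x)) i m a (l x) (init x)
        (fun y hy => (rsize_le_of_mem hy).trans hl₀) (hQ x)).seq runs_pop_aux)))).mono ?_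
    have h₂ : (l x).length ≤ R.eval (rsize x) := (length_lt_rsize _).le.trans hl₀
    have h₃ := Nat.mul_le_mul_right (12 * R.eval (rsize x) +
      P.eval (R.eval (rsize x) + Q.eval (rsize x) + 1) + 6) h₂
    have h₄ : (rep (l x)).size ≤ R.eval (rsize x) := hl₀
    simp [eval_comp]
    omega

omit [TreeRep γ] in
theorem rsize_foldl_le {step : β → γ → β} {G : ℕ} {l : List γ}
    (h : ∀ y, ∀ x ∈ l, rsize (step y x) ≤ rsize y + G) (y : β) :
    rsize (l.foldl step y) ≤ rsize y + l.length * G := by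
  induction l generalizing y with
  | nil => simp
  | cons x l ih =>
    have h₁ := ih (fun y z hz => h y z (List.mem_cons_of_mem _ hz)) (step y x)
    have h₂ := h y x List.mem_cons_self
    simp only [List.foldl_cons, List.length_cons, Nat.succ_mul]
    omega

open Polynomial in
theorem foldl {l : α → List γ} {init : α → β} {step : α → β → γ → β} (hl : PT l)
    (hi : PT init) (hs : PT fun p : γ × α × β => step p.2.1 p.2.2 p.1) (G : Polynomial ℕ)
    (hG : ∀ x y, ∀ z ∈ l x, rsize (step x y z) ≤ rsize y + G.eval (rsize x)) :
    PT fun x => (l x).foldl (step x) (init x) := by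
  have key (x : α) (l' : List γ) (y : β) :
      l'.foldl (fun (q : α × β) z => (q.1, step q.1 q.2 z)) (x, y) = (x, l'.foldl (step x) y) := by
    induction l' generalizing y with
    | nil => rfl
    | cons z l' ih => exact ih _
  obtain ⟨_, R, hR⟩ := hl.pair hi
  have := foldl_of_bound hl (PT.id.pair hi) (step := fun (q : α × β) z => (q.1, step q.1 q.2 z))
    (id.snd.fst.pair hs) (X + R + R * G + 1) fun x l' hl' => ?_
  · simpa only [key] using this.snd
  · rw [key]
    have h₁ := rsize_foldl_le (fun y z hz => hG x y z (hl'.subset hz)) (init x)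
    have h₂ := (hR x).1
    have h₃ : l'.length ≤ R.eval (rsize x) := by
      have := hl'.length_le
      have := length_lt_rsize (l x)
      simp at h₂
      omega
    have h₄ := Nat.mul_le_mul_right (G.eval (rsize x)) h₃
    simp at h₂ ⊢
    omega

end PT

end SDI

namespace SDI

open Prog TreeRep

theorem rsize_tail_le {α : Type} [TreeRep α] (l : List α) : rsize l.tail ≤ rsize l := by
  cases l <;> simp; omega

theorem rsize_bool_le (b : Bool) : rsize b ≤ 3 := by cases b <;> decide

namespace PT

variable {α β γ δ : Type} [TreeRep α] [TreeRep β] [TreeRep γ] [TreeRep δ]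

theorem exists_rsize_le {f : α → β} (hf : PT f) :
    ∃ P : Polynomial ℕ, ∀ x, rsize (f x) ≤ P.eval (rsize x) :=
  let ⟨_, P, hP⟩ := hf
  ⟨P, fun x => (hP x).1⟩

open Polynomial in
theorem reverse {l : α → List β} (hl : PT l) : PT fun x => (l x).reverse := by
  obtain ⟨R, hR⟩ := hl.exists_rsize_le
  have := foldl hl (const []) (step := fun _ y z => z :: y) (id.fst.cons id.snd.snd) (R + 1)
    fun x y z hz => by
      have h₁ := (rsize_le_of_mem hz).trans (hR x)
      simp; omega
  simpa using this

open Polynomial in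
theorem append {l l' : α → List β} (hl : PT l) (hl' : PT l') : PT fun x => l x ++ l' x := by
  obtain ⟨R, hR⟩ := hl.reverse.exists_rsize_le
  have := foldl hl.reverse hl' (step := fun _ y z => z :: y) (id.fst.cons id.snd.snd) (R + 1)
    fun x y z hz => by
      have h₁ := (rsize_le_of_mem hz).trans (hR x)
      simp; omega
  simpa using this

open Polynomial in
theorem flatMap {l : α → List γ} {f : α → γ → List β} (hl : PT l)
    (hf : PT fun p : γ × α => f p.2 p.1) : PT fun x => (l x).flatMap (f x) := by
  obtain ⟨R, hR⟩ := hl.exists_rsize_le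
  obtain ⟨P, hP⟩ := hf.exists_rsize_le
  have := foldl hl (const []) (step := fun x y z => y ++ f x z)
    (id.snd.snd.append (hf.comp (id.fst.pair id.snd.fst))) (P.comp (R + X + 1))
    fun x y z hz => by
      have h₁ := (rsize_le_of_mem hz).trans (hR x)
      have h₂ := hP (z, x)
      have h₃ := eval_le_eval P (a := rsize (z, x)) (b := R.eval (rsize x) + rsize x + 1)
        (by simp; omega)
      have h₄ := rsize_append y (f x z)
      simp [eval_comp] at h₂ h₃ ⊢; omega
  simpa [List.flatMap_eq_foldl] using this

open Polynomial in
theorem any {l : α → List γ} {f : α → γ → Bool} (hl : PT l)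
    (hf : PT fun p : γ × α => f p.2 p.1) : PT fun x => (l x).any (f x) := by
  have key (g : γ → Bool) (l : List γ) (b : Bool) :
      l.foldl (fun y z => y || g z) b = (b || l.any g) := by
    induction l generalizing b with
    | nil => simp
    | cons z l ih => simp [ih, Bool.or_assoc]
  have := foldl hl (const false) (step := fun x y z => y || f x z)
    (id.snd.snd.or (hf.comp (id.fst.pair id.snd.fst))) (C 3)
    fun x y z hz => by
      have := rsize_bool_le (y || f x z)
      simp; omega
  simpa [key] using this

theorem eqBool {f g : α → Bool} (hf : PT f) (hg : PT g) : PT fun x => decide (f x = g x) := by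
  convert hf.ite hg hg.not using 2 with x
  cases f x <;> cases g x <;> rfl

open Polynomial in
theorem eqList [DecidableEq β] [Inhabited β] (hd : rep (default : β) = .leaf)
    (hβ : PT fun p : β × β => decide (p.1 = p.2)) {f g : α → List β} (hf : PT f) (hg : PT g) :
    PT fun x => decide (f x = g x) := by
  let step (q : Bool × List β) (z : β) : Bool × List β :=
    (q.1 && (!q.2.isEmpty && decide (z = q.2.headI)), q.2.tail)
  have key (l : List β) (b : Bool) (l' : List β) :
      ((l.foldl step (b, l')).1 && (l.foldl step (b, l')).2.isEmpty) =
        (b && decide (l = l')) := by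
    induction l generalizing b l' with
    | nil => cases l' <;> simp
    | cons z l ih =>
      cases l' with
      | nil => simp [step, ih]
      | cons z' l' =>
        simp [step, ih, Bool.and_assoc]
        congr
  have := foldl hf ((const true).pair hg) (step := fun _ => step)
    ((id.snd.snd.fst.and (id.snd.snd.snd.isEmpty.not.and
      (hβ.comp (id.fst.pair (id.snd.snd.snd.headI hd))))).pair id.snd.snd.snd.tail) (C 3)
    fun x y z hz => by
      have h₁ := rsize_bool_le (step y z).1
      have h₂ := rsize_tail_le y.2
      have h₃ : rsize y = rsize y.1 + rsize y.2 + 1 := rsize_mk y.1 y.2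
      have h₄ : rsize (step y z) = rsize (step y z).1 + rsize y.2.tail + 1 := rsize_mk _ _
      simp; omega
  simpa [key] using this.fst.and this.snd.isEmpty

end PT

end SDI

namespace SDI

open TreeRep

/-! ### The algorithm -/

/-- Numbers in binary. -/
abbrev Bits := List Bool

/-- Transitions of an automaton. -/
abbrev Trans := Bits × Bits × Bits

/-- The code of a symbol by two bits. -/
def symBits : InputSym → Bool × Bool
  | .bit b => (false, b)
  | .comma => (true, false)
  | .bar => (true, true)

/-- Adds a symbol to the left of a word that is split at its bars and commas. -/
def splitStep (acc : List (List Bits)) (s : Bool × Bool) : List (List Bits) :=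
  if s.1 then (if s.2 then [] :: acc else ([] :: acc.headI) :: acc.tail)
  else ((s.2 :: acc.headI.headI) :: acc.headI.tail) :: acc.tail

/-- Collects the elements of a list in triples. -/
def tripleStep (q : List Bits × List Trans) (x : Bits) : List Bits × List Trans :=
  if q.1.tail.isEmpty then (x :: q.1, q.2) else ([], (q.1.tail.headI, q.1.headI, x) :: q.2)

/-- The triples of a list, in reverse order. -/
def triples (l : List Bits) : List Trans := (l.foldl tripleStep ([], [])).2

/-- The nodes `[t, p, q]` of a graph consist of a phase `t` and states `p` and `q` of two automata.
The phases are `[]` (inside of `u`), `[false]` (after `u`) and `[true]` (inside of `v`).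
These are the arcs that belong to a transition of either automaton. -/
def arcs (a b : Trans) : List (List Bits × List Bits) :=
  ([[false], a.2.2, b.1], [[false], a.2.2, b.2.2]) ::
    if a.2.1 = b.2.1 then
      [([[], a.1, b.1], [[], a.2.2, b.2.2]), ([[], a.1, b.1], [[false], a.2.2, b.2.2]),
        ([[false], a.1, b.1], [[true], a.2.2, b.2.2]), ([[true], a.1, b.1], [[true], a.2.2, b.2.2])]
    else []

/-- The targets of the arcs with source in a list. -/
def targets {α : Type} [DecidableEq α] (E : List (α × α)) (S : List α) : List α :=
  E.flatMap fun e => if S.any fun x => decide (e.1 = x) then [e.2] else []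

/-- The nodes that can be reached from `s`. -/
def reach {α : Type} [DecidableEq α] (E : List (α × α)) (s : α) : List α :=
  E.foldl (fun S _ => S ++ targets E S) [s]

/-- The arcs of all pairs of transitions. -/
def allArcs (A B : List Trans) : List (List Bits × List Bits) :=
  A.flatMap fun a => B.flatMap fun b => arcs a b

/-- Decides independence for an instance that is split at its bars and commas. -/
def independentSplit (s : List (List Bits)) : Bool :=
  !(s.headI.tail.tail.tail.any fun f => s.tail.tail.headI.tail.tail.any fun g =>
    (reach (allArcs (triples s.tail.headI) (triples s.tail.tail.tail.headI))
      [[], s.headI.tail.tail.headI, s.tail.tail.headI.tail.headI]).any fun x =>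
        decide (x = [[true], f, g]))

/-- Decides independence for the reversed code of an instance. -/
def independentCode (l : List (Bool × Bool)) : Bool := independentSplit (l.foldl splitStep [])

namespace PT

variable {α β γ : Type} [TreeRep α] [TreeRep β] [TreeRep γ]

theorem eqBits {f g : α → Bits} (hf : PT f) (hg : PT g) : PT fun x => decide (f x = g x) :=
  eqList rfl (eqBool id.fst id.snd) hf hg

theorem eqNode {f g : α → List Bits} (hf : PT f) (hg : PT g) : PT fun x => decide (f x = g x) :=
  eqList rfl (eqBits id.fst id.snd) hf hg

theorem anyPair {l : α → List γ} {F : γ × α → Bool} (hl : PT l) (hF : PT F) :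
    PT fun x => (l x).any fun z => F (z, x) :=
  any hl (f := fun x z => F (z, x)) hF

theorem triple {t p q : α → Bits} (ht : PT t) (hp : PT p) (hq : PT q) :
    PT fun x => [t x, p x, q x] := ht.cons (hp.cons (hq.cons (const [])))

open Polynomial in
theorem split {l : α → List (Bool × Bool)} (hl : PT l) :
    PT fun x => (l x).foldl splitStep [] := by
  have hb : PT fun p : (Bool × Bool) × α × List (List Bits) => p.1.2 := id.fst.snd
  have ha : PT fun p : (Bool × Bool) × α × List (List Bits) => p.2.2 := id.snd.snd
  refine foldl hl (const []) (step := fun _ => splitStep)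
    (ite id.fst.fst (ite hb ((const []).cons ha)
      (((const []).cons (ha.headI rfl)).cons ha.tail))
      (((hb.cons ((ha.headI rfl).headI rfl)).cons (ha.headI rfl).tail).cons ha.tail)) (C 10)
    fun x y z hz => ?_
  obtain ⟨b, b'⟩ := z
  have hb := rsize_bool_le b'
  have h₁ : (default : Bits) = [] := rfl
  have h₂ : (default : List Bits) = [] := rfl
  cases b
  · rcases y with _ | ⟨_ | ⟨_, _⟩, _⟩
    · simp [splitStep, h₁, h₂]
      omega
    · simp [splitStep, List.headI, h₁]
      omega
    · simp [splitStep, List.headI]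
      omega
  · cases b'
    · rcases y with _ | ⟨_, _⟩
      · simp [splitStep, List.headI, h₂]
      · simp [splitStep, List.headI]
        omega
    · simp [splitStep]; omega

open Polynomial in
theorem triples {l : α → List Bits} (hl : PT l) : PT fun x => triples (l x) := by
  obtain ⟨R, hR⟩ := hl.exists_rsize_le
  have hp : PT fun p : Bits × α × List Bits × List Trans => p.2.2.1 := id.snd.snd.fst
  have ho : PT fun p : Bits × α × List Bits × List Trans => p.2.2.2 := id.snd.snd.snd
  refine (foldl hl (const ([], [])) (step := fun _ => tripleStep)
    (ite hp.tail.isEmpty ((id.fst.cons hp).pair ho) ((const []).pair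
      (((hp.tail.headI rfl).pair ((hp.headI rfl).pair id.fst)).cons ho))) (R + C 10)
    fun x y z hz => ?_).snd
  have h := (rsize_le_of_mem hz).trans (hR x)
  obtain ⟨_ | ⟨_, _ | ⟨_, _⟩⟩, o⟩ := y <;> simp [tripleStep, List.headI] <;> omega

theorem arcs {a b : α → Trans} (ha : PT a) (hb : PT b) : PT fun x => arcs (a x) (b x) := by
  have e₀ : PT fun _ : α => ([] : Bits) := const _
  have e₁ : PT fun _ : α => [false] := const _
  have e₂ : PT fun _ : α => [true] := const _
  have hn : PT fun _ : α => ([] : List (List Bits × List Bits)) := const _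
  refine ((e₁.triple ha.snd.snd hb.fst).pair (e₁.triple ha.snd.snd hb.snd.snd)).cons ?_
  convert ite (eqBits ha.snd.fst hb.snd.fst)
    (((e₀.triple ha.fst hb.fst).pair (e₀.triple ha.snd.snd hb.snd.snd)).cons
      (((e₀.triple ha.fst hb.fst).pair (e₁.triple ha.snd.snd hb.snd.snd)).cons
      (((e₁.triple ha.fst hb.fst).pair (e₂.triple ha.snd.snd hb.snd.snd)).cons
      (((e₂.triple ha.fst hb.fst).pair (e₂.triple ha.snd.snd hb.snd.snd)).cons hn)))) hn using 2
  simp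

theorem allArcs {A B : α → List Trans} (hA : PT A) (hB : PT B) :
    PT fun x => allArcs (A x) (B x) :=
  flatMap hA (f := fun x a => (B x).flatMap fun b => SDI.arcs a b)
    (flatMap (hB.comp id.snd) (f := fun p b => SDI.arcs p.1 b) (arcs id.snd.fst id.fst))

theorem targets {E : α → List (List Bits × List Bits)} {S : α → List (List Bits)} (hE : PT E)
    (hS : PT S) : PT fun x => targets (E x) (S x) :=
  flatMap hE (f := fun x (e : List Bits × List Bits) =>
      if (S x).any fun y => decide (e.1 = y) then [e.2] else [])
    (ite (any (hS.comp id.snd) (f := fun (p : (List Bits × List Bits) × α) y => decide (p.1.1 = y))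
        (eqNode id.snd.fst.fst id.fst))
      (id.fst.snd.cons (const [])) (const []))

theorem rsize_targets_le (E : List (List Bits × List Bits)) (S : List (List Bits)) :
    rsize (SDI.targets E S) ≤ rsize E := by
  induction E with
  | nil => exact le_rfl
  | cons e E ih =>
    have h : SDI.targets (e :: E) S =
        (if S.any fun x => decide (e.1 = x) then [e.2] else []) ++ SDI.targets E S := rfl
    have h₁ := rsize_append (if S.any fun x => decide (e.1 = x) then [e.2] else [])
      (SDI.targets E S)
    have h₂ : rsize e = rsize e.1 + rsize e.2 + 1 := rsize_mk e.1 e.2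
    rw [h, rsize_cons]
    split_ifs at h₁ ⊢
    · simp at h₁ ⊢; omega
    · simp at h₁ ⊢; omega

theorem reach {E : α → List (List Bits × List Bits)} {s : α → List Bits} (hE : PT E) (hs : PT s) :
    PT fun x => reach (E x) (s x) := by
  obtain ⟨R, hR⟩ := hE.exists_rsize_le
  refine foldl hE (hs.cons (const [])) (step := fun x S _ => S ++ SDI.targets (E x) S)
    (id.snd.snd.append (targets (hE.comp id.snd.fst) id.snd.snd)) R fun x S z hz => ?_
  have h₁ := rsize_append S (SDI.targets (E x) S)
  have h₂ := rsize_targets_le (E x) S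
  have h₃ := hR x
  omega

theorem independentSplit : PT independentSplit := by
  have h₁ : PT fun s : List (List Bits) => s.headI := id.headI rfl
  have h₂ : PT fun s : List (List Bits) => s.tail.headI := id.tail.headI rfl
  have h₃ : PT fun s : List (List Bits) => s.tail.tail.headI := id.tail.tail.headI rfl
  have h₄ : PT fun s : List (List Bits) => s.tail.tail.tail.headI := id.tail.tail.tail.headI rfl
  have hr := reach (h₂.triples.allArcs h₄.triples)
    ((const []).triple (h₁.tail.tail.headI rfl) (h₃.tail.headI rfl))
  have e : PT fun x : List Bits × Bits × Bits × List (List Bits) =>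
      decide (x.1 = [[true], x.2.2.1, x.2.1]) :=
    eqNode id.fst ((const [true]).triple id.snd.snd.fst id.snd.fst)
  have e₁ := anyPair (hr.comp (id.snd.snd (α := Bits × Bits × List (List Bits)))) e
  have e₂ := anyPair (h₃.tail.tail.comp (id.snd (α := Bits × List (List Bits)))) e₁
  have e₃ := anyPair h₁.tail.tail.tail e₂
  exact e₃.not

theorem independentCode : PT independentCode := independentSplit.comp id.split

end PT

end SDI

namespace SDI

open Prog TreeRep

/-! ### Reading the input and writing the output -/

/-- Moves a symbol of the input to the list on `main`. -/
def readAs (s : InputSym) : Prog Stk.Sym :=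
  seq (pop .inp) (seq (pushAll (rep (symBits s)).code) (push (Γ := Stk.Sym) .main true))

/-- Moves the next symbol of the input to the list on `main`. -/
def readSym : Prog Stk.Sym :=
  ite .inp (fun o : Option InputSym => decide (o = some .comma)) (readAs .comma) <|
    ite .inp (fun o : Option InputSym => decide (o = some .bar)) (readAs .bar) <|
      ite .inp (fun o : Option InputSym => decide (o = some (.bit true))) (readAs (.bit true))
        (readAs (.bit false))

/-- Moves the input to a list on `main`. -/
def readLoop : Prog Stk.Sym := loop .inp (fun o : Option InputSym => o.isSome) readSym

theorem rsize_symBits_le (s : InputSym) : rsize (symBits s) ≤ 7 := by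
  have h₁ := rsize_bool_le (symBits s).1
  have h₂ := rsize_bool_le (symBits s).2
  have h₃ : rsize (symBits s) = _ := rsize_mk (symBits s).1 (symBits s).2
  omega

theorem runs_readAs (s : InputSym) (i : List InputSym) (l : List (Bool × Bool)) :
    Runs (readAs s) (cfg (s :: i) (rep l).code [] [] [])
      (cfg i (rep (symBits s :: l)).code [] [] []) 10 := by
  have e : (rep (symBits s :: l)).code = true :: ((rep (symBits s)).code ++ (rep l).code) := by
    simp [rep_cons, BTree.code]
  rw [e]
  have h : (rep (symBits s)).code.length ≤ 7 := rsize_symBits_le s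
  exact (runs_pop_inp.seq ((runs_pushAll _).seq runs_push_main)).mono (by omega)

theorem runs_readSym (s : InputSym) (i : List InputSym) (l : List (Bool × Bool)) :
    Runs readSym (cfg (s :: i) (rep l).code [] [] [])
      (cfg i (rep (symBits s :: l)).code [] [] []) 13 := by
  match s with
  | .comma => exact (Runs.ite_true rfl (runs_readAs _ i l)).mono (by omega)
  | .bar => exact (Runs.ite_false rfl (Runs.ite_true rfl (runs_readAs _ i l))).mono (by omega)
  | .bit true =>
    exact Runs.ite_false rfl (Runs.ite_false rfl (Runs.ite_true rfl (runs_readAs _ i l)))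
  | .bit false =>
    exact Runs.ite_false rfl (Runs.ite_false rfl (Runs.ite_false rfl (runs_readAs _ i l)))

theorem runs_readLoop (i : List InputSym) (l : List (Bool × Bool)) :
    Runs readLoop (cfg i (rep l).code [] [] [])
      (cfg [] (rep ((i.map symBits).reverse ++ l)).code [] [] []) (14 * i.length + 1) := by
  induction i generalizing l with
  | nil => exact Runs.loop_done rfl
  | cons s i ih =>
    refine (Runs.loop_more rfl (runs_readSym s i l) ?_).mono
      (t := 13 + (14 * i.length + 1) + 1) (by simp; omega)
    have := ih (symBits s :: l)
    rw [List.map_cons, List.reverse_cons, List.append_assoc]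
    exact this

theorem rsize_map_symBits_le (w : List InputSym) :
    rsize (w.map symBits).reverse ≤ 8 * w.length + 1 := by
  rw [rsize_reverse]
  induction w with
  | nil => simp
  | cons s w ih =>
    have := rsize_symBits_le s
    simp
    omega

/-- Replaces the tree of a Boolean value on `main` by the value. -/
def writeBool : Prog Stk.Sym :=
  ifMain (seq (pop .main) (seq (pop .main) (seq (pop .main) (push (Γ := Stk.Sym) .main true)))) skip

theorem runs_writeBool (b : Bool) :
    Runs writeBool (cfg [] (rep b).code [] [] []) (cfg [] [b] [] [] []) 5 := by
  cases b
  · exact (runs_ifMain_false runs_skip).mono (by omega)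
  · exact runs_ifMain_true (runs_pop_main.seq (runs_pop_main.seq (runs_pop_main.seq
      runs_push_main)))

open Polynomial in
theorem PT.decidableInPolyTime {ι : Type} {enc : ι → List InputSym} {P : ι → Prop}
    {g : List (Bool × Bool) → Bool} (hg : PT g)
    (h : ∀ i, g ((enc i).map symBits).reverse = true ↔ P i) : DecidableInPolyTime enc P := by
  refine ⟨fun i => g ((enc i).map symBits).reverse, h, ?_⟩
  obtain ⟨p, Q, hp⟩ := hg
  let M : Prog Stk.Sym :=
    seq (push (Γ := Stk.Sym) .main false) (seq readLoop (seq p writeBool))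
  have : Fintype (Stk.Sym .inp) := inferInstanceAs (Fintype InputSym)
  have hM (i : ι) := Runs.outputs (p := M) (k₀ := Stk.inp) (k₁ := Stk.main) (l := enc i)
    (l' := [g ((enc i).map symBits).reverse])
    (t := (C 14 * X + Q.comp (C 8 * X + 1) + C 7 : ℕ[X]).eval (enc i).length) (by
      have h₁ := (hp ((enc i).map symBits).reverse).2 [] [] []
      have h₂ := runs_readLoop (enc i) []
      simp only [List.append_nil] at h₁ h₂
      refine runs_of_eq ((runs_push_main.seq (h₂.seq (h₁.seq (runs_writeBool _)))).mono ?_)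
        (s₁ := cfg (enc i) [] [] [] []) (by funext k; cases k <;> rfl)
        (by funext k; cases k <;> rfl)
      have h₃ := eval_le_eval Q (rsize_map_symBits_le (enc i))
      simp [eval_comp]
      omega)
  exact ⟨
    { tm := M.machine Stk.inp Stk.main
      inputAlphabet := Equiv.refl InputSym
      outputAlphabet := Equiv.refl Bool
      time := C 14 * X + Q.comp (C 8 * X + 1) + C 7 + 1
      outputsFun := fun i => by
        have e₁ : List.map (Equiv.refl InputSym).invFun (enc i) = enc i := List.map_id _
        have e₂ (l : List Bool) : List.map (Equiv.refl Bool).invFun l = l := List.map_id _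
        rw [Polynomial.eval_add, Polynomial.eval_one]
        exact Eq.mpr (congrArg₂ (fun a b => Turing.TM2OutputsInTime (M.machine Stk.inp Stk.main)
          a (some b) _) e₁ (e₂ _)) (hM i).some }⟩

end SDI

namespace SDI

/-! ### Correctness of the algorithm -/

section Reach

variable {α : Type} [DecidableEq α]

theorem mem_targets {E : List (α × α)} {S : List α} {y : α} :
    y ∈ targets E S ↔ ∃ x ∈ S, (x, y) ∈ E := by
  simp only [targets, List.mem_flatMap]
  constructor
  · rintro ⟨⟨x, z⟩, he, hy⟩
    split_ifs at hy with h
    · simp only [List.mem_singleton] at hy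
      simp only [List.any_eq_true, decide_eq_true_eq, exists_eq_right'] at h
      exact ⟨x, h, hy ▸ he⟩
    · simp at hy
  · rintro ⟨x, hx, he⟩
    exact ⟨_, he, by simp [hx]⟩

theorem mem_reach {E : List (α × α)} {s y : α} :
    y ∈ reach E s ↔ Relation.ReflTransGen (fun x y => (x, y) ∈ E) s y := by
  let f (S : List α) : List α := S ++ targets E S
  have hmono (S : List α) (n : ℕ) : S ⊆ f^[n] S := by
    induction n with
    | zero => simp
    | succ n ih =>
      rw [Function.iterate_succ_apply']
      exact List.Subset.trans ih (List.subset_append_left _ _)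
  have hreach : reach E s = f^[E.length] [s] := by
    have (l : List (α × α)) (S : List α) : l.foldl (fun S _ => f S) S = f^[l.length] S := by
      induction l generalizing S with
      | nil => rfl
      | cons e l ih => simp [ih]
    exact this E [s]
  have hsound (n : ℕ) : ∀ y ∈ f^[n] [s], Relation.ReflTransGen (fun x y => (x, y) ∈ E) s y := by
    induction n with
    | zero => simpa using Relation.ReflTransGen.refl
    | succ n ih =>
      rw [Function.iterate_succ_apply']
      intro y hy
      rcases List.mem_append.1 hy with hy | hy
      · exact ih y hy
      · obtain ⟨x, hx, he⟩ := mem_targets.1 hy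
        exact (ih x hx).tail he
  have hcount (n : ℕ) : (∀ x ∈ f^[n] [s], ∀ y, (x, y) ∈ E → y ∈ f^[n] [s]) ∨
      n + 1 ≤ (E.toFinset.filter fun e => e.2 ∈ f^[n + 1] [s]).card := by
    induction n with
    | zero =>
      by_cases h : ∃ e ∈ E, e.2 ∈ f [s]
      · obtain ⟨e, he, hs⟩ := h
        exact Or.inr (Finset.card_pos.2 ⟨e, by simpa [he] using hs⟩)
      · refine Or.inl fun x hx y hy => absurd ⟨_, hy, ?_⟩ h
        exact List.mem_append_right _ (mem_targets.2 ⟨x, hx, hy⟩)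
    | succ n ih =>
      by_cases h : ∀ x ∈ f^[n + 1] [s], ∀ y, (x, y) ∈ E → y ∈ f^[n + 1] [s]
      · exact Or.inl h
      · push Not at h
        obtain ⟨x, hx, y, hy, hn⟩ := h
        rcases ih with ih | ih
        · have hfix : f^[n + 1] [s] ⊆ f^[n] [s] := by
            rw [Function.iterate_succ_apply']
            refine List.append_subset.2 ⟨List.Subset.refl _, fun z hz => ?_⟩
            obtain ⟨w, hw, he⟩ := mem_targets.1 hz
            exact ih w hw z he
          refine absurd ?_ hn
          rw [Function.iterate_succ_apply']
          exact List.mem_append_left _ (ih x (hfix hx) y hy)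
        · refine Or.inr (ih.trans_lt (Finset.card_lt_card ?_))
          rw [Finset.ssubset_iff_of_subset]
          · refine ⟨(x, y), ?_, fun h => hn (Finset.mem_filter.1 h).2⟩
            rw [Function.iterate_succ_apply']
            simp only [Finset.mem_filter, List.mem_toFinset]
            exact ⟨hy, List.mem_append_right _ (mem_targets.2 ⟨x, hx, hy⟩)⟩
          · intro e
            rw [Function.iterate_succ_apply' f (n + 1)]
            simp only [Finset.mem_filter, List.mem_toFinset]
            exact fun h => ⟨h.1, List.mem_append_left _ h.2⟩
  rw [hreach]
  refine ⟨hsound _ y, fun h => ?_⟩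
  have hclosed : ∀ x ∈ f^[E.length] [s], ∀ y, (x, y) ∈ E → y ∈ f^[E.length] [s] := by
    refine (hcount E.length).resolve_right fun h => ?_
    have := h.trans ((Finset.card_filter_le _ _).trans E.toFinset_card_le)
    omega
  induction h with
  | refl => exact hmono _ _ (by simp)
  | tail _ he ih => exact hclosed _ ih _ he

end Reach

section Split

/-- Splits a word at its bars and commas, to the left of what is already split. -/
def splitWord (w : List InputSym) (acc : List (List Bits)) : List (List Bits) :=
  w.foldr (fun s acc => splitStep acc (symBits s)) acc

theorem splitWord_append (w w' : List InputSym) (acc : List (List Bits)) :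
    splitWord (w ++ w') acc = splitWord w (splitWord w' acc) := List.foldr_append

theorem splitWord_bar (acc : List (List Bits)) : splitWord [.bar] acc = [] :: acc := rfl

theorem splitWord_encodeNum (n : ℕ) (h : List Bits) (t : List (List Bits)) :
    splitWord (encodeNum n) (h :: t) = (Computability.encodeNat n :: h) :: t := by
  rw [encodeNum, splitWord_append]
  have h₀ : splitWord [.comma] (h :: t) = ([] :: h) :: t := rfl
  rw [h₀]
  induction Computability.encodeNat n with
  | nil => rfl
  | cons b l ih =>
    have : splitWord ((b :: l).map InputSym.bit) (([] :: h) :: t) =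
      splitStep (splitWord (l.map InputSym.bit) (([] :: h) :: t)) (false, b) := rfl
    rw [this, ih]
    rfl

theorem splitWord_flatMap {α : Type} {f : α → List InputSym} {g : α → List Bits}
    (hf : ∀ x h t, splitWord (f x) (h :: t) = (g x ++ h) :: t) (l : List α) (h : List Bits)
    (t : List (List Bits)) : splitWord (l.flatMap f) (h :: t) = (l.flatMap g ++ h) :: t := by
  induction l with
  | nil => rfl
  | cons x l ih => simp [splitWord_append, ih, hf]

/-- A transition in binary. -/
def transBits {k : ℕ} {A : Automaton k} (t : Fin A.n × Fin k × Fin A.n) : Trans :=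
  (Computability.encodeNat t.1, Computability.encodeNat t.2.1, Computability.encodeNat t.2.2)

theorem splitWord_encodeAutomaton {k : ℕ} (A : Automaton k) (acc : List (List Bits)) :
    splitWord (encodeAutomaton A) acc =
      (Computability.encodeNat A.n :: Computability.encodeNat A.start ::
        (A.finals.map Fin.val).map Computability.encodeNat) ::
      (A.transitions.map transBits).flatMap (fun t => [t.1, t.2.1, t.2.2]) :: acc := by
  have e : encodeAutomaton A = encodeNum A.n ++ encodeNum A.start ++
      (A.finals.map Fin.val).flatMap encodeNum ++ [InputSym.bar] ++
      A.transitions.flatMap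
        (fun t => encodeNum t.1 ++ encodeNum t.2.1 ++ encodeNum t.2.2) ++ [InputSym.bar] := by
    simp only [encodeAutomaton, bind_pure_comp, List.map_eq_map]
  rw [e]
  simp only [splitWord_append, splitWord_bar]
  rw [splitWord_flatMap (g := fun t : Fin A.n × Fin k × Fin A.n =>
      [(transBits t).1, (transBits t).2.1, (transBits t).2.2]) (fun t h l => by
      simp only [splitWord_append, splitWord_encodeNum]; rfl),
    splitWord_flatMap (g := fun q => [Computability.encodeNat q])
      (fun t h l => splitWord_encodeNum _ _ _)]
  simp [splitWord_encodeNum, List.flatMap_map, ← List.map_eq_flatMap]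

theorem foldl_tripleStep (l out : List Trans) :
    (l.flatMap fun t => [t.1, t.2.1, t.2.2]).foldl tripleStep ([], out) =
      ([], l.reverse ++ out) := by
  induction l generalizing out with
  | nil => rfl
  | cons t l ih =>
    have : tripleStep (tripleStep (tripleStep ([], out) t.1) t.2.1) t.2.2 = ([], t :: out) := rfl
    simp [this, ih]

theorem triples_flatMap (l : List Trans) :
    triples (l.flatMap fun t => [t.1, t.2.1, t.2.2]) = l.reverse := by
  simp [triples, foldl_tripleStep]

end Split

theorem encodeNat_injective : Function.Injective Computability.encodeNat :=
  Function.LeftInverse.injective Computability.decode_encodeNat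

section Graph

variable {k : ℕ} {A B : Automaton k}

theorem mem_transitions {p q : Fin A.n} {a : Fin k} :
    (p, a, q) ∈ A.transitions ↔ q ∈ A.step p a := by
  simp [Automaton.transitions, List.mem_product]

/-- The graph that is searched by the algorithm. -/
def graph (A B : Automaton k) : List (List Bits × List Bits) :=
  allArcs (A.transitions.map transBits).reverse (B.transitions.map transBits).reverse

theorem mem_graph {e : List Bits × List Bits} : e ∈ graph A B ↔
    ∃ p a p' q b q', p' ∈ A.step p a ∧ q' ∈ B.step q b ∧
      e ∈ arcs (transBits (A := A) (p, a, p')) (transBits (A := B) (q, b, q')) := by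
  simp only [graph, allArcs, List.mem_flatMap, List.mem_reverse, List.mem_map]
  constructor
  · rintro ⟨_, ⟨⟨p, a, p'⟩, ha, rfl⟩, _, ⟨⟨q, b, q'⟩, hb, rfl⟩, he⟩
    exact ⟨p, a, p', q, b, q', mem_transitions.1 ha, mem_transitions.1 hb, he⟩
  · rintro ⟨p, a, p', q, b, q', ha, hb, he⟩
    exact ⟨_, ⟨_, mem_transitions.2 ha, rfl⟩, _, ⟨_, mem_transitions.2 hb, rfl⟩, he⟩

/-- A node of the graph. -/
def node (t : Bits) (p : Fin A.n) (q : Fin B.n) : List Bits :=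
  [t, Computability.encodeNat p, Computability.encodeNat q]

theorem node_inj {t t' : Bits} {p p' : Fin A.n} {q q' : Fin B.n}
    (h : node t p q = node t' p' q') : t = t' ∧ p = p' ∧ q = q' := by
  simp only [node, List.cons.injEq, and_true] at h
  exact ⟨h.1, Fin.ext (encodeNat_injective h.2.1), Fin.ext (encodeNat_injective h.2.2)⟩

/-- The arcs of the graph, in terms of states. -/
inductive Arc (A B : Automaton k) : List Bits → List Bits → Prop
  | insert {p p' a q b q'} : p' ∈ A.step p a → q' ∈ B.step q b →
      Arc A B (node [false] p' q) (node [false] p' q')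
  | left {p p' a q q'} : p' ∈ A.step p a → q' ∈ B.step q a → Arc A B (node [] p q) (node [] p' q')
  | left_last {p p' a q q'} : p' ∈ A.step p a → q' ∈ B.step q a →
      Arc A B (node [] p q) (node [false] p' q')
  | right_first {p p' a q q'} : p' ∈ A.step p a → q' ∈ B.step q a →
      Arc A B (node [false] p q) (node [true] p' q')
  | right {p p' a q q'} : p' ∈ A.step p a → q' ∈ B.step q a →
      Arc A B (node [true] p q) (node [true] p' q')

theorem mem_graph_iff {x y : List Bits} : (x, y) ∈ graph A B ↔ Arc A B x y := by
  rw [mem_graph]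
  constructor
  · rintro ⟨p, a, p', q, b, q', ha, hb, he⟩
    rcases List.mem_cons.1 he with he | he
    · cases he
      exact .insert ha hb
    · split_ifs at he with hab
      · obtain rfl : a = b := Fin.ext (encodeNat_injective hab)
        simp only [List.mem_cons, List.not_mem_nil, or_false] at he
        rcases he with he | he | he | he <;> cases he
        exacts [.left ha hb, .left_last ha hb, .right_first ha hb, .right ha hb]
      · simp at he
  · rintro (⟨ha, hb⟩ | ⟨ha, hb⟩ | ⟨ha, hb⟩ | ⟨ha, hb⟩ | ⟨ha, hb⟩) <;>
      exact ⟨_, _, _, _, _, _, ha, hb, by simp [arcs, transBits, node]⟩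

theorem mem_eval_append_singleton {p' : Fin A.n} {u : List (Fin k)} {a : Fin k} :
    p' ∈ A.toNFA.eval (u ++ [a]) ↔ ∃ p ∈ A.toNFA.eval u, p' ∈ A.step p a := by
  rw [NFA.eval_append_singleton, NFA.mem_stepSet]
  rfl

/-- The words that lead to a node. -/
inductive Labelled (A B : Automaton k) : List Bits → Prop
  | left {u p q} : p ∈ A.toNFA.eval u → q ∈ B.toNFA.eval u → Labelled A B (node [] p q)
  | insert {u z p q} : u ≠ [] → p ∈ A.toNFA.eval u → q ∈ B.toNFA.eval (u ++ z) →
      Labelled A B (node [false] p q)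
  | right {u z v p q} : u ≠ [] → v ≠ [] → p ∈ A.toNFA.eval (u ++ v) →
      q ∈ B.toNFA.eval (u ++ z ++ v) → Labelled A B (node [true] p q)

theorem Labelled.step {x y : List Bits} (hx : Labelled A B x) (h : Arc A B x y) :
    Labelled A B y := by
  have key {P : List (Fin k) → Prop} {w w' : List (Fin k)} {a : Fin k} (h : P (w ++ w' ++ [a])) :
      P (w ++ (w' ++ [a])) := by rwa [← List.append_assoc]
  generalize hx' : x = x' at hx
  cases h with
  | @insert p p' a q b q' hp hq =>
    rcases hx with ⟨h₁, h₂⟩ | ⟨hu, h₁, h₂⟩ | ⟨hu, hv, h₁, h₂⟩ <;>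
      obtain ⟨ht, rfl, rfl⟩ := node_inj hx' <;> simp at ht
    exact .insert hu h₁ (key (P := fun w => q' ∈ B.toNFA.eval w)
      (mem_eval_append_singleton.2 ⟨_, h₂, hq⟩))
  | left hp hq =>
    rcases hx with ⟨h₁, h₂⟩ | ⟨hu, h₁, h₂⟩ | ⟨hu, hv, h₁, h₂⟩ <;>
      obtain ⟨ht, rfl, rfl⟩ := node_inj hx' <;> simp at ht
    exact .left (mem_eval_append_singleton.2 ⟨_, h₁, hp⟩)
      (mem_eval_append_singleton.2 ⟨_, h₂, hq⟩)
  | @left_last p p' a q q' hp hq =>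
    rcases hx with ⟨h₁, h₂⟩ | ⟨hu, h₁, h₂⟩ | ⟨hu, hv, h₁, h₂⟩ <;>
      obtain ⟨ht, rfl, rfl⟩ := node_inj hx' <;> simp at ht
    refine .insert (z := []) (List.append_ne_nil_of_right_ne_nil _ (List.cons_ne_nil a []))
      (mem_eval_append_singleton.2 ⟨_, h₁, hp⟩) ?_
    rw [List.append_nil]
    exact mem_eval_append_singleton.2 ⟨_, h₂, hq⟩
  | @right_first p p' a q q' hp hq =>
    rcases hx with ⟨h₁, h₂⟩ | ⟨hu, h₁, h₂⟩ | ⟨hu, hv, h₁, h₂⟩ <;>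
      obtain ⟨ht, rfl, rfl⟩ := node_inj hx' <;> simp at ht
    exact .right hu (List.cons_ne_nil a []) (mem_eval_append_singleton.2 ⟨_, h₁, hp⟩)
      (mem_eval_append_singleton.2 ⟨_, h₂, hq⟩)
  | @right p p' a q q' hp hq =>
    rcases hx with ⟨h₁, h₂⟩ | ⟨hu, h₁, h₂⟩ | ⟨hu, hv, h₁, h₂⟩ <;>
      obtain ⟨ht, rfl, rfl⟩ := node_inj hx' <;> simp at ht
    exact .right hu (List.append_ne_nil_of_right_ne_nil _ (List.cons_ne_nil a []))
      (key (P := fun w => p' ∈ A.toNFA.eval w) (mem_eval_append_singleton.2 ⟨_, h₁, hp⟩))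
      (key (P := fun w => q' ∈ B.toNFA.eval w) (mem_eval_append_singleton.2 ⟨_, h₂, hq⟩))

theorem labelled_of_reach {x : List Bits}
    (h : Relation.ReflTransGen (Arc A B) (node [] A.start B.start) x) : Labelled A B x := by
  induction h with
  | refl => exact .left (u := []) rfl rfl
  | tail _ h ih => exact ih.step h

theorem reach_left {u : List (Fin k)} : ∀ {p : Fin A.n} {q : Fin B.n}, p ∈ A.toNFA.eval u →
    q ∈ B.toNFA.eval u →
    Relation.ReflTransGen (Arc A B) (node [] A.start B.start) (node [] p q) := by
  induction u using List.reverseRecOn with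
  | nil =>
    rintro p q rfl rfl
    exact .refl
  | append_singleton u a ih =>
    intro p q hp hq
    obtain ⟨p₀, hp₀, hp⟩ := mem_eval_append_singleton.1 hp
    obtain ⟨q₀, hq₀, hq⟩ := mem_eval_append_singleton.1 hq
    exact (ih hp₀ hq₀).tail (.left hp hq)

theorem reach_insert {u z : List (Fin k)} (hu : u ≠ []) : ∀ {p : Fin A.n} {q : Fin B.n},
    p ∈ A.toNFA.eval u → q ∈ B.toNFA.eval (u ++ z) →
    Relation.ReflTransGen (Arc A B) (node [] A.start B.start) (node [false] p q) := by
  obtain ⟨u, a, rfl⟩ := (List.eq_nil_or_concat' u).resolve_left hu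
  induction z using List.reverseRecOn with
  | nil =>
    intro p q hp hq
    rw [List.append_nil] at hq
    obtain ⟨p₀, hp₀, hp⟩ := mem_eval_append_singleton.1 hp
    obtain ⟨q₀, hq₀, hq⟩ := mem_eval_append_singleton.1 hq
    exact (reach_left hp₀ hq₀).tail (.left_last hp hq)
  | append_singleton z b ih =>
    intro p q hp hq
    rw [← List.append_assoc] at hq
    obtain ⟨q₀, hq₀, hq⟩ := mem_eval_append_singleton.1 hq
    obtain ⟨p₀, -, hp₀⟩ := mem_eval_append_singleton.1 hp
    exact (ih hp hq₀).tail (.insert hp₀ hq)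

theorem reach_right {u z v : List (Fin k)} (hu : u ≠ []) (hv : v ≠ []) :
    ∀ {p : Fin A.n} {q : Fin B.n}, p ∈ A.toNFA.eval (u ++ v) → q ∈ B.toNFA.eval (u ++ z ++ v) →
    Relation.ReflTransGen (Arc A B) (node [] A.start B.start) (node [true] p q) := by
  induction v using List.reverseRecOn with
  | nil => exact absurd rfl hv
  | append_singleton v a ih =>
    intro p q hp hq
    rw [← List.append_assoc] at hp hq
    obtain ⟨p₀, hp₀, hp'⟩ := mem_eval_append_singleton.1 hp
    obtain ⟨q₀, hq₀, hq'⟩ := mem_eval_append_singleton.1 hq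
    by_cases h : v = []
    · subst h
      rw [List.append_nil] at hp₀ hq₀
      exact (reach_insert hu hp₀ hq₀).tail (.right_first hp' hq')
    · exact (ih h hp₀ hq₀).tail (.right hp' hq')

end Graph

/-- Some word of the second language arises from a word of the first one by an insertion between two
nonempty words. -/
def Dependent {α : Type*} (L R : Language α) : Prop :=
  ∃ u z v : List α, u ≠ [] ∧ v ≠ [] ∧ u ++ v ∈ L ∧ u ++ z ++ v ∈ R

theorem independentCode_iff (I : Instance) :
    independentCode ((encodeInstance I).map symBits).reverse = true ↔
      ¬ Dependent I.A.language I.B.language := by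
  have hs : List.foldl splitStep [] ((encodeInstance I).map symBits).reverse =
      splitWord (encodeInstance I) [] := by
    rw [List.foldl_reverse, List.foldr_map]
    rfl
  have hi : splitWord (encodeInstance I) [] =
      (Computability.encodeNat I.k :: Computability.encodeNat I.A.n ::
        Computability.encodeNat I.A.start ::
        (I.A.finals.map Fin.val).map Computability.encodeNat) ::
      (I.A.transitions.map transBits).flatMap (fun t => [t.1, t.2.1, t.2.2]) ::
      (Computability.encodeNat I.B.n :: Computability.encodeNat I.B.start ::
        (I.B.finals.map Fin.val).map Computability.encodeNat) ::
      (I.B.transitions.map transBits).flatMap (fun t => [t.1, t.2.1, t.2.2]) :: [] := by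
    simp only [encodeInstance, splitWord_append, splitWord_encodeAutomaton, splitWord_encodeNum]
  have hg (x y : List Bits) : y ∈ reach (graph I.A I.B) x ↔
      Relation.ReflTransGen (Arc I.A I.B) x y := by
    simp only [mem_reach, mem_graph_iff]
  rw [independentCode, hs, hi, independentSplit, Bool.not_eq_true', ← Bool.not_eq_true, not_iff_not]
  simp only [List.headI, List.tail, triples_flatMap, List.any_eq_true, decide_eq_true_eq,
    exists_eq_right, List.mem_map, exists_exists_and_eq_and]
  change (∃ p ∈ I.A.finals, ∃ q ∈ I.B.finals, node [true] p q ∈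
    reach (graph I.A I.B) (node [] I.A.start I.B.start)) ↔ _
  simp only [hg, Automaton.finals, List.mem_filter, List.mem_finRange, true_and, decide_eq_true_eq]
  constructor
  · rintro ⟨p, hp, q, hq, h⟩
    generalize hx : node [true] p q = x at h
    rcases labelled_of_reach h with ⟨h₁, h₂⟩ | ⟨hu, h₁, h₂⟩ | ⟨hu, hv, h₁, h₂⟩ <;>
      obtain ⟨ht, rfl, rfl⟩ := node_inj hx <;> simp at ht
    exact ⟨_, _, _, hu, hv, ⟨p, hp, h₁⟩, ⟨q, hq, h₂⟩⟩
  · rintro ⟨u, z, v, hu, hv, ⟨p, hp, h₁⟩, ⟨q, hq, h₂⟩⟩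
    exact ⟨p, hp, q, hq, reach_right hu hv h₁ h₂⟩

theorem independent_iff {α : Type*} {op : List α → List α → Language α} {L R : Language α} :
    Independent op L R ↔ ¬ ∃ x ∈ L, ∃ y, y ≠ [] ∧ ∃ w ∈ op x y, w ∈ R := by
  rw [Independent, eq_bot_iff, ← not_iff_not, not_not]
  constructor
  · intro h
    by_contra hn
    exact h fun w ⟨⟨x, hx, y, hy, hw⟩, hR⟩ => hn ⟨x, hx, y, hy, w, hw, hR⟩
  · rintro ⟨x, hx, y, hy, w, hw, hR⟩ h
    exact h ⟨⟨x, hx, y, hy, hw⟩, hR⟩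

/-- An insertion between `u` and `v` is maximal when its sites are all of `u` and `v`. -/
theorem independent_maxSDI_iff {α : Type*} {L R : Language α} :
    Independent maxSDI L R ↔ ¬ Dependent L R := by
  rw [independent_iff, not_iff_not]
  constructor
  · rintro ⟨_, hx, _, -, _, ⟨x₁, u, z, v, x₂, rfl, rfl, -, hu, hv, -⟩, hR⟩
    exact ⟨x₁ ++ u, z, v ++ x₂, by simp [hu], by simp [hv], by simpa using hx, by simpa using hR⟩
  · rintro ⟨u, z, v, hu, hv, hL, hR⟩
    refine ⟨u ++ v, hL, u ++ z ++ v, by simp [hu], _,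
      ⟨[], u, z, v, [], rfl, by simp, rfl, hu, hv, ?_⟩, by simpa using hR⟩
    rintro ⟨x₁, x₂, h₁, h₂, h, -⟩
    simp [List.suffix_nil.1 h₁, List.prefix_nil.1 h₂] at h

/-- An insertion between `u` and `v` is minimal when its sites are the last letter of `u` and the
first letter of `v`. -/
theorem independent_minSDI_iff {α : Type*} {L R : Language α} :
    Independent minSDI L R ↔ ¬ Dependent L R := by
  rw [independent_iff, not_iff_not]
  constructor
  · rintro ⟨_, hx, _, -, _, ⟨x₁, u, z, v, x₂, rfl, rfl, -, hu, hv, -⟩, hR⟩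
    exact ⟨x₁ ++ u, z, v ++ x₂, by simp [hu], by simp [hv], by simpa using hx, by simpa using hR⟩
  · rintro ⟨u, z, v, hu, hv, hL, hR⟩
    obtain ⟨u, a, rfl⟩ := (List.eq_nil_or_concat' u).resolve_left hu
    obtain ⟨b, v, rfl⟩ := List.exists_cons_of_ne_nil hv
    refine ⟨_, hL, [a] ++ z ++ [b], by simp, _, ⟨u, [a], z, [b], v, rfl, by simp, rfl, by simp,
      by simp, ?_, ?_⟩, by simpa using hR⟩
    · rintro ⟨s, hs, hne, -, h⟩
      exact hne (h.eq_of_length_le (List.length_pos_of_ne_nil hs))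
    · rintro ⟨s, hs, hne, h, -⟩
      exact hne (h.eq_of_length_le (List.length_pos_of_ne_nil hs))

end SDI

theorem theorem3 :
    SDI.DecidableInPolyTime SDI.encodeInstance
      (fun I => SDI.Independent SDI.maxSDI I.A.language I.B.language) ∧
    SDI.DecidableInPolyTime SDI.encodeInstance
      (fun I => SDI.Independent SDI.minSDI I.A.language I.B.language) :=
  ⟨SDI.PT.independentCode.decidableInPolyTime fun I =>
      (SDI.independentCode_iff I).trans SDI.independent_maxSDI_iff.symm,
    SDI.PT.independentCode.decidableInPolyTime fun I =>
      (SDI.independentCode_iff I).trans SDI.independent_minSDI_iff.symm⟩
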